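/- Let $T_{528}$ be the cellular automaton on $\{0,1\}^{\mathbb Z^2}$ given by $$(T_{528}u)_{i,j}=u_{i,j}+u_{i+1,j}+u_{i,j-1}+u_{i-1,j}+u_{i,j+1}\pmod 2,$$ and let $u_o$ be the configuration with $(u_o)_{(0,0)}=1$ and all other entries $0$. For $n\ge 0$ let $num(n)$ be the number of nonzero entries of $T_{528}^n u_o$, and for $n\ge -1$ let $cum(n)=\sum_{m=0}^{n} num(m)$, so that $cum(-1)=0$. **Theorem.** There is exactly one function $f_{T528}:[0,1]\to[0,1]$ such that, for every sequence $x_1,x_2,\ldots\in\{0,1\}$ and $x=\sum_{i=1}^\infty x_i/2^i$, $$f_{T528}(x)=\lim_{k\to\infty}\frac{cum\left(\left(\sum_{i=1}^k x_i2^{k-i}\right)-1\right)}{cum(2^k-1)} .$$ In particular, this limit always exists and is the same for the two binary expansions of a dyadic rational. Moreover, for every such sequence, $$f_{T528}(x)=\sum_{i=1}^{\infty}x_i\,\alpha^i\prod_{s=0}^{i-1}\left(\frac{17+7\sqrt{17}}{34}\left(\frac{3+\sqrt{17}}{2}\right)^s+\frac{17-7\sqrt{17}}{34}\left(\frac{3-\sqrt{17}}{2}\right)^s\right)^{p_{i,s}},$$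 where the series converges absolutely, $\alpha=(\sqrt2-1)/2$, and, for $s\ge1$, $p_{i,s}$ is the number of clusters (maximal blocks) consisting of exactly $s$ consecutive $1$s in the word $x_1x_2\cdots x_{i-1}$. (The factor with $s=0$ equals $1$ whatever the value of $p_{i,0}$; put $p_{i,0}=0$.) -/

import Mathlib

open Filter Topology

/-- Configurations of the two-dimensional two-state lattice `{0,1}^(ℤ²)`. -/
abbrev Config : Type := ℤ × ℤ → ZMod 2

/-- The single site seed: `1` at the origin and `0` elsewhere. -/
def singleSiteSeed : Config := fun p => if p = (0, 0) then 1 else 0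

/-- Local rules on the von Neumann neighborhood; the arguments are `U`, `L`, `C`, `R`, `D`. -/
abbrev LocalRule : Type := ZMod 2 → ZMod 2 → ZMod 2 → ZMod 2 → ZMod 2 → ZMod 2

/-- The two-dimensional elementary cellular automaton with local rule `t`. -/
def globalMap (t : LocalRule) (u : Config) : Config := fun p =>
  t (u (p.1, p.2 + 1)) (u (p.1 - 1, p.2)) (u p) (u (p.1 + 1, p.2)) (u (p.1, p.2 - 1))

/-- The local rule of `T₅₂₈`: the sum modulo `2` of the five cells of the neighborhood. -/
def rule528 : LocalRule := fun U L C R D => C + R + D + L + U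

/-- The transition table of `T₅₂₈`, one line for each class of neighborhoods under the symmetries
of the square. -/
theorem rule528_table :
    rule528 1 1 1 1 1 = 1 ∧ rule528 0 1 1 1 1 = 0 ∧ rule528 1 0 1 0 1 = 1 ∧
    rule528 0 0 1 1 1 = 1 ∧ rule528 0 0 1 0 1 = 0 ∧ rule528 0 0 1 0 0 = 1 ∧
    rule528 1 1 0 1 1 = 0 ∧ rule528 0 1 0 1 1 = 1 ∧ rule528 1 0 0 0 1 = 0 ∧
    rule528 0 0 0 1 1 = 0 ∧ rule528 0 0 0 0 1 = 1 ∧ rule528 0 0 0 0 0 = 0 := by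
  decide

/-- The cellular automaton `T₅₂₈`. -/
def T528 : Config → Config := globalMap rule528

/-- The number of nonzero states in the spatial pattern `T^n u₀`, where `u₀` is the single site
seed. -/
noncomputable def num (T : Config → Config) (n : ℕ) : ℕ :=
  {p : ℤ × ℤ | (T^[n] singleSiteSeed) p ≠ 0}.ncard

/-- The cumulative number of nonzero states from time step `0` to time step `n`; in particular
`cum T (-1) = 0`. -/
noncomputable def cum (T : Config → Config) (n : ℤ) : ℕ :=
  ∑ m ∈ Finset.range (n + 1).toNat, num T m

/-- The number `∑_{i ≥ 1} x_i / 2^i` of `[0,1]` with binary digits `x_1, x_2, …`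
(the entry `x_0` is not used). -/
noncomputable def binaryValue (x : ℕ → Fin 2) : Set.Icc (0 : ℝ) 1 :=
  ⟨Real.ofDigits (fun i => x (i + 1)), Real.ofDigits_nonneg _, Real.ofDigits_le_one _⟩

/-- `binaryValue x` is the sum of the series `∑_{i ≥ 1} x_i / 2^i`. -/
theorem hasSum_binaryValue (x : ℕ → Fin 2) :
    HasSum (fun i : ℕ => ((x (i + 1) : ℕ) : ℝ) / 2 ^ (i + 1)) (binaryValue x : ℝ) := by
  have h := (Real.summable_ofDigitsTerm (digits := fun i => x (i + 1))).hasSum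
  convert h using 2 with i
  · simp [Real.ofDigitsTerm, div_eq_mul_inv]
  · rfl

/-- The normalized number of nonzero states
`cum_T((∑_{i=1}^k x_i 2^(k-i)) - 1) / cum_T(2^k - 1)`. -/
noncomputable def normalizedCum (T : Config → Config) (x : ℕ → Fin 2) (k : ℕ) : ℝ :=
  (cum T ((∑ i ∈ Finset.Icc 1 k, ((x i : ℕ) : ℤ) * 2 ^ (k - i)) - 1) : ℝ) /
    (cum T (2 ^ k - 1) : ℝ)

/-- `f` is the function `f_T : [0,1] → [0,1]` of the cellular automaton `T`: for every binary
expansion `x = ∑ x_i / 2^i`, the normalized numbers of nonzero states converge to `f x`. -/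
def IsLimitFunction (T : Config → Config) (f : Set.Icc (0 : ℝ) 1 → Set.Icc (0 : ℝ) 1) : Prop :=
  ∀ x : ℕ → Fin 2, Tendsto (normalizedCum T x) atTop (𝓝 (f (binaryValue x) : ℝ))

/-- `p_{i,s}`: the number of clusters (maximal blocks) consisting of `s` consecutive `1`s in
`x_1 x_2 ⋯ x_{i-1}`. A cluster is given by its first position `a`; it occupies the positions
`a, …, a + s - 1`. -/
def clusterCount (x : ℕ → Fin 2) (i s : ℕ) : ℕ :=
  ((Finset.Icc 1 (i - 1)).filter fun a =>
    1 ≤ s ∧ a + s ≤ i ∧ (∀ j ∈ Finset.Ico a (a + s), x j = 1) ∧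
      (a = 1 ∨ x (a - 1) = 0) ∧ (a + s = i ∨ x (a + s) = 0)).card

/-- The numbers `c₊ λ₊^s + c₋ λ₋^s` with `c_± = (17 ± 7 √17) / 34` and `λ_± = (3 ± √17) / 2`. -/
noncomputable def clusterFactor (s : ℕ) : ℝ :=
  (17 + 7 * √17) / 34 * ((3 + √17) / 2) ^ s + (17 - 7 * √17) / 34 * ((3 - √17) / 2) ^ s

/-!
Over `𝔽₂`, the pattern after `n` steps is the Laurent polynomial `Pⁿ` with
`P = 1 + x + x⁻¹ + y + y⁻¹`, and squaring is the substitution `(x, y) ↦ (x², y²)`. Hence the pattern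
at time `2 n` is the dilation of the pattern at time `n` (`iterate_two_mul_seed`), and sorting the
cells at times `2 n` and `2 n + 1` by parity gives linear recursions for the pair `(num, edgeNum)`,
where `edgeNum n` counts the monomials of `(1 + x) Pⁿ`: a digit `0` maps `(a, b)` to `(a, 2 a)`, a
digit `1` maps it to `(a + 2 b, 2 a + 2 b)`.

The first map has rank one, so that a digit `0` makes what precedes it and what follows it
independent (`num_concat`). Consequently `num n` is the product, over the clusters of ones in the
binary expansion of `n`, of the numbers `num (2 ^ s - 1)`, and these are the numbers `clusterFactor s`
because `(3 ± √17) / 2` are the eigenvalues of the second map (`num_prefixValue`). Moreover the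
times before `∑ x_i 2 ^ (k - i)` fall into blocks, one for each digit `x_i = 1`, which
contribute `num (x_1 ⋯ x_{i-1}) * blockSum (k - i)` (`sum_num_prefixValue`), where
`blockSum k = cum (2 ^ k - 1)`.

The sum of the two maps has the eigenvalues `2 ± 2 √2`, and `α` is the reciprocal of `2 + 2 √2`.
Therefore `blockSum (k - i) / blockSum k` tends to `α ^ i`, and dominated convergence gives the limit
as a series (`tendsto_normalizedCum`); the domination holds as `num n ≤ 2 * 4 ^ i` for `n < 2 ^ i`
while `blockSum` grows at least by the factor `9 / 2`. The limit depends only on the number and not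
on its binary expansion, since the prefixes of two expansions of the same number differ by at most
one (`normalizedCum_le_of_binaryValue_eq`).
-/

/-! ### Supports of configurations -/

/-- The number of nonzero cells of a configuration (`0` if there are infinitely many). -/
noncomputable def supportCard (w : Config) : ℕ := {p | w p ≠ 0}.ncard

theorem supportCard_zero : supportCard (fun _ => 0) = 0 := by simp [supportCard]

theorem supportCard_comp_equiv (w : Config) (e : ℤ × ℤ ≃ ℤ × ℤ) :
    supportCard (fun p => w (e p)) = supportCard w :=
  Set.ncard_preimage_of_injective_subset_range e.injective (s := {p | w p ≠ 0})
    (by simp [e.surjective.range_eq])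

theorem supportCard_comp_add (w : Config) (a b : ℤ) :
    supportCard (fun p => w (p.1 + a, p.2 + b)) = supportCard w :=
  supportCard_comp_equiv w ((Equiv.addRight a).prodCongr (Equiv.addRight b))

theorem ncard_eq_add_of_parity_fst {S : Set (ℤ × ℤ)} (hS : S.Finite) :
    S.ncard = {p : ℤ × ℤ | (2 * p.1, p.2) ∈ S}.ncard +
      {p : ℤ × ℤ | (2 * p.1 + 1, p.2) ∈ S}.ncard := by
  have h0 : Function.Injective fun p : ℤ × ℤ => (2 * p.1, p.2) := by
    rintro ⟨a, b⟩ ⟨c, d⟩ h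
    simp only [Prod.mk.injEq] at h ⊢
    omega
  have h1 : Function.Injective fun p : ℤ × ℤ => (2 * p.1 + 1, p.2) := by
    rintro ⟨a, b⟩ ⟨c, d⟩ h
    simp only [Prod.mk.injEq] at h ⊢
    omega
  rw [← Set.ncard_image_of_injective {p : ℤ × ℤ | (2 * p.1, p.2) ∈ S} h0,
    ← Set.ncard_image_of_injective {p : ℤ × ℤ | (2 * p.1 + 1, p.2) ∈ S} h1,
    ← Set.ncard_union_eq ?_ (hS.subset ?_) (hS.subset ?_)]
  · congr 1
    ext ⟨a, b⟩
    simp only [Set.mem_union, Set.mem_image, Set.mem_ofPred_eq, Prod.mk.injEq, Prod.exists]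
    constructor
    · intro h
      rcases Int.even_or_odd' a with ⟨c, rfl | rfl⟩
      · exact Or.inl ⟨c, b, h, rfl, rfl⟩
      · exact Or.inr ⟨c, b, h, rfl, rfl⟩
    · rintro (⟨c, d, h, rfl, rfl⟩ | ⟨c, d, h, rfl, rfl⟩) <;> exact h
  · rw [Set.disjoint_left]
    rintro _ ⟨⟨a, b⟩, -, rfl⟩ ⟨⟨c, d⟩, -, h⟩
    simp only [Prod.mk.injEq] at h
    omega
  · rintro _ ⟨p, hp, rfl⟩
    exact hp
  · rintro _ ⟨p, hp, rfl⟩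
    exact hp

theorem supportCard_eq_add_fst {w : Config} (hw : {p | w p ≠ 0}.Finite) :
    supportCard w = supportCard (fun p => w (2 * p.1, p.2)) +
      supportCard (fun p => w (2 * p.1 + 1, p.2)) :=
  ncard_eq_add_of_parity_fst hw

theorem supportCard_eq_add_snd {w : Config} (hw : {p | w p ≠ 0}.Finite) :
    supportCard w = supportCard (fun p => w (p.1, 2 * p.2)) +
      supportCard (fun p => w (p.1, 2 * p.2 + 1)) := by
  have hw' : {p : ℤ × ℤ | w p.swap ≠ 0}.Finite := hw.preimage (Prod.swap_injective.injOn)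
  have h := supportCard_eq_add_fst (w := fun p => w p.swap) hw'
  have e := supportCard_comp_equiv w (Equiv.prodComm ℤ ℤ)
  have e0 := supportCard_comp_equiv (fun p => w (p.1, 2 * p.2)) (Equiv.prodComm ℤ ℤ)
  have e1 := supportCard_comp_equiv (fun p => w (p.1, 2 * p.2 + 1)) (Equiv.prodComm ℤ ℤ)
  simp only [Equiv.prodComm_apply, Prod.fst_swap, Prod.snd_swap] at e e0 e1
  rw [← e, ← e0, ← e1, h]
  rfl

/-- The nonzero cells of a configuration, counted in the four parity classes of the lattice. -/
theorem supportCard_eq_add_parity {w : Config} (hw : {p | w p ≠ 0}.Finite) :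
    supportCard w =
      supportCard (fun p => w (2 * p.1, 2 * p.2)) +
      supportCard (fun p => w (2 * p.1, 2 * p.2 + 1)) +
      supportCard (fun p => w (2 * p.1 + 1, 2 * p.2)) +
      supportCard (fun p => w (2 * p.1 + 1, 2 * p.2 + 1)) := by
  have h0 : {p : ℤ × ℤ | w (2 * p.1, p.2) ≠ 0}.Finite := by
    refine hw.preimage (f := fun p : ℤ × ℤ => (2 * p.1, p.2)) (Function.Injective.injOn ?_)
    rintro ⟨a, b⟩ ⟨c, d⟩ h
    simp only [Prod.mk.injEq] at h ⊢
    omega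
  have h1 : {p : ℤ × ℤ | w (2 * p.1 + 1, p.2) ≠ 0}.Finite := by
    refine hw.preimage (f := fun p : ℤ × ℤ => (2 * p.1 + 1, p.2)) (Function.Injective.injOn ?_)
    rintro ⟨a, b⟩ ⟨c, d⟩ h
    simp only [Prod.mk.injEq] at h ⊢
    omega
  rw [supportCard_eq_add_fst hw, supportCard_eq_add_snd h0, supportCard_eq_add_snd h1]
  ring

/-! ### Self-similarity of the automaton -/

theorem T528_apply (u : Config) (i j : ℤ) :
    T528 u (i, j) = u (i, j) + u (i + 1, j) + u (i, j - 1) + u (i - 1, j) + u (i, j + 1) := rfl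

/-- The dilation of a configuration by the factor `2`, with zeros off the even sublattice. In terms
of Laurent polynomials over `𝔽₂` it is the substitution `(x, y) ↦ (x², y²)`, that is, squaring. -/
def dilate (u : Config) : Config := fun p =>
  if p.1 % 2 = 0 ∧ p.2 % 2 = 0 then u (p.1 / 2, p.2 / 2) else 0

theorem dilate_apply {u : Config} {i j : ℤ} (a b : ℤ) (hi : i = 2 * a) (hj : j = 2 * b) :
    dilate u (i, j) = u (a, b) := by
  subst hi hj
  simp [dilate]

theorem dilate_apply_odd_fst {u : Config} {i j : ℤ} (a : ℤ) (hi : i = 2 * a + 1) :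
    dilate u (i, j) = 0 :=
  if_neg fun h => by have := h.1; simp only at this; omega

theorem dilate_apply_odd_snd {u : Config} {i j : ℤ} (b : ℤ) (hj : j = 2 * b + 1) :
    dilate u (i, j) = 0 :=
  if_neg fun h => by have := h.2; simp only at this; omega

theorem dilate_singleSiteSeed : dilate singleSiteSeed = singleSiteSeed := by
  funext ⟨i, j⟩
  rcases Int.even_or_odd' i with ⟨a, rfl | rfl⟩
  · rcases Int.even_or_odd' j with ⟨b, rfl | rfl⟩
    · rw [dilate_apply a b rfl rfl]
      simp [singleSiteSeed]
    · rw [dilate_apply_odd_snd b rfl]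
      have : 2 * b + 1 ≠ 0 := by omega
      simp [singleSiteSeed, this]
  · rw [dilate_apply_odd_fst a rfl]
    have : 2 * a + 1 ≠ 0 := by omega
    simp [singleSiteSeed, this]

theorem T528_dilate_even_even (u : Config) (a b : ℤ) :
    T528 (dilate u) (2 * a, 2 * b) = u (a, b) := by
  rw [T528_apply, dilate_apply a b rfl rfl, dilate_apply_odd_fst a rfl,
    dilate_apply_odd_snd (b - 1) (by ring), dilate_apply_odd_fst (a - 1) (by ring),
    dilate_apply_odd_snd b rfl]
  ring

theorem T528_dilate_odd_even (u : Config) (a b : ℤ) :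
    T528 (dilate u) (2 * a + 1, 2 * b) = u (a, b) + u (a + 1, b) := by
  rw [T528_apply, dilate_apply_odd_fst a rfl, dilate_apply (a + 1) b (by ring) rfl,
    dilate_apply_odd_snd (b - 1) (by ring), dilate_apply a b (by ring) rfl,
    dilate_apply_odd_snd b rfl]
  ring

theorem T528_dilate_even_odd (u : Config) (a b : ℤ) :
    T528 (dilate u) (2 * a, 2 * b + 1) = u (a, b) + u (a, b + 1) := by
  rw [T528_apply, dilate_apply_odd_snd b rfl, dilate_apply_odd_fst a rfl,
    dilate_apply a b rfl (by ring), dilate_apply_odd_fst (a - 1) (by ring),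
    dilate_apply a (b + 1) rfl (by ring)]
  ring

theorem T528_dilate_odd_odd (u : Config) (a b : ℤ) :
    T528 (dilate u) (2 * a + 1, 2 * b + 1) = 0 := by
  rw [T528_apply, dilate_apply_odd_snd b rfl, dilate_apply_odd_snd b rfl,
    dilate_apply_odd_fst a rfl, dilate_apply_odd_snd b rfl, dilate_apply_odd_fst a rfl]
  ring

/-- Two steps of the automaton add the four cells at distance `2`: squaring is additive over
`𝔽₂`. -/
theorem T528_T528_apply (u : Config) (i j : ℤ) :
    T528 (T528 u) (i, j) =
      u (i, j) + u (i + 2, j) + u (i, j - 2) + u (i - 2, j) + u (i, j + 2) := by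
  have e1 : i + 1 + 1 = i + 2 := by ring
  have e2 : i - 1 - 1 = i - 2 := by ring
  have e3 : j + 1 + 1 = j + 2 := by ring
  have e4 : j - 1 - 1 = j - 2 := by ring
  simp only [T528_apply, e1, e2, e3, e4, sub_add_cancel, add_sub_cancel_right]
  linear_combination (2 * u (i, j) + u (i + 1, j) + u (i - 1, j) + u (i, j + 1) + u (i, j - 1) +
    u (i + 1, j + 1) + u (i + 1, j - 1) + u (i - 1, j + 1) + u (i - 1, j - 1)) *
      (CharTwo.two_eq_zero (R := ZMod 2))

theorem T528_T528_dilate (u : Config) : T528 (T528 (dilate u)) = dilate (T528 u) := by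
  funext ⟨i, j⟩
  rw [T528_T528_apply]
  rcases Int.even_or_odd' i with ⟨a, rfl | rfl⟩
  · rcases Int.even_or_odd' j with ⟨b, rfl | rfl⟩
    · rw [dilate_apply a b rfl rfl, dilate_apply (a + 1) b (by ring) rfl,
        dilate_apply a (b - 1) rfl (by ring), dilate_apply (a - 1) b (by ring) rfl,
        dilate_apply a (b + 1) rfl (by ring), dilate_apply a b rfl rfl, T528_apply]
    · rw [dilate_apply_odd_snd b rfl, dilate_apply_odd_snd b rfl,
        dilate_apply_odd_snd (b - 1) (by ring), dilate_apply_odd_snd b rfl,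
        dilate_apply_odd_snd (b + 1) (by ring), dilate_apply_odd_snd b rfl]
      ring
  · rw [dilate_apply_odd_fst a rfl, dilate_apply_odd_fst (a + 1) (by ring),
      dilate_apply_odd_fst a rfl, dilate_apply_odd_fst (a - 1) (by ring),
      dilate_apply_odd_fst a rfl, dilate_apply_odd_fst a rfl]
    ring

theorem iterate_two_mul_seed (n : ℕ) :
    T528^[2 * n] singleSiteSeed = dilate (T528^[n] singleSiteSeed) := by
  induction n with
  | zero => exact dilate_singleSiteSeed.symm
  | succ n ih =>
    rw [show 2 * (n + 1) = 2 * n + 1 + 1 by ring, Function.iterate_succ_apply',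
      Function.iterate_succ_apply', ih, T528_T528_dilate, ← Function.iterate_succ_apply' T528]

theorem iterate_two_mul_add_one_seed (n : ℕ) :
    T528^[2 * n + 1] singleSiteSeed = T528 (dilate (T528^[n] singleSiteSeed)) := by
  rw [Function.iterate_succ_apply', iterate_two_mul_seed]

theorem finite_support_comp_add {u : Config} (hu : {p | u p ≠ 0}.Finite) (a b : ℤ) :
    {p : ℤ × ℤ | u (p.1 + a, p.2 + b) ≠ 0}.Finite :=
  hu.preimage (((Equiv.addRight a).prodCongr (Equiv.addRight b)).injective.injOn)

theorem finite_support_T528 {u : Config} (hu : {p | u p ≠ 0}.Finite) :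
    {p | T528 u p ≠ 0}.Finite := by
  refine (((((finite_support_comp_add hu 0 0).union (finite_support_comp_add hu 1 0)).union
    (finite_support_comp_add hu 0 (-1))).union (finite_support_comp_add hu (-1) 0)).union
    (finite_support_comp_add hu 0 1)).subset ?_
  rintro ⟨i, j⟩ h
  contrapose! h
  simp only [Set.mem_union, Set.mem_ofPred_eq, not_or, not_not, add_zero, ← sub_eq_add_neg] at h
  obtain ⟨⟨⟨⟨h1, h2⟩, h3⟩, h4⟩, h5⟩ := h
  simp [T528_apply, h1, h2, h3, h4, h5]

theorem finite_support_iterate_seed (n : ℕ) : {p | (T528^[n] singleSiteSeed) p ≠ 0}.Finite := by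
  induction n with
  | zero =>
    refine (Set.finite_singleton (0, 0)).subset fun p hp => ?_
    by_contra h
    exact hp (if_neg h)
  | succ n ih =>
    rw [Function.iterate_succ_apply']
    exact finite_support_T528 ih

theorem iterate_seed_swap (n : ℕ) (p : ℤ × ℤ) :
    (T528^[n] singleSiteSeed) p.swap = (T528^[n] singleSiteSeed) p := by
  induction n generalizing p with
  | zero => simp [singleSiteSeed, Prod.ext_iff, and_comm]
  | succ n ih =>
    obtain ⟨i, j⟩ := p
    simp only [Function.iterate_succ_apply', Prod.swap_prod_mk, T528_apply]
    simp only [← ih (i, _), ← ih (_, j), Prod.swap_prod_mk]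
    ring

/-! ### The number of nonzero cells -/

/-- The number of nonzero cells of `T₅₂₈ⁿ u₀` added to its horizontal translate by one cell, that
is, the number of monomials of `(1 + x) Pⁿ` over `𝔽₂`, where `P = 1 + x + x⁻¹ + y + y⁻¹`. -/
noncomputable def edgeNum (n : ℕ) : ℕ :=
  supportCard fun p => (T528^[n] singleSiteSeed) p + (T528^[n] singleSiteSeed) (p.1 + 1, p.2)

theorem supportCard_iterate_seed (n : ℕ) : supportCard (T528^[n] singleSiteSeed) = num T528 n := rfl

theorem edgeNum_eq_vertical (n : ℕ) : edgeNum n =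
    supportCard fun p => (T528^[n] singleSiteSeed) p + (T528^[n] singleSiteSeed) (p.1, p.2 + 1) := by
  rw [edgeNum, ← supportCard_comp_equiv _ (Equiv.prodComm ℤ ℤ)]
  congr 1
  funext p
  simp only [Equiv.prodComm_apply, iterate_seed_swap, Prod.fst_swap, Prod.snd_swap]
  rw [← iterate_seed_swap n (p.1, p.2 + 1), Prod.swap_prod_mk]

theorem finite_support_edge (n : ℕ) : {p | (T528^[n] singleSiteSeed) p +
    (T528^[n] singleSiteSeed) (p.1 + 1, p.2) ≠ 0}.Finite := by
  refine ((finite_support_iterate_seed n).union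
    (finite_support_comp_add (finite_support_iterate_seed n) 1 0)).subset fun p h => ?_
  contrapose! h
  simp only [Set.mem_union, Set.mem_ofPred_eq, not_or, not_not, add_zero] at h
  simp [h.1, h.2]

theorem num_zero : num T528 0 = 1 := by
  rw [num, Set.ncard_eq_one]
  refine ⟨(0, 0), ?_⟩
  ext p
  simp [singleSiteSeed]

theorem num_two_mul (n : ℕ) : num T528 (2 * n) = num T528 n := by
  rw [← supportCard_iterate_seed, supportCard_eq_add_parity (finite_support_iterate_seed _),
    iterate_two_mul_seed]
  simp only [dilate_apply _ _ rfl rfl, dilate_apply_odd_fst _ rfl, dilate_apply_odd_snd _ rfl,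
    supportCard_zero, add_zero]
  rfl

theorem num_two_mul_add_one (n : ℕ) :
    num T528 (2 * n + 1) = num T528 n + 2 * edgeNum n := by
  rw [← supportCard_iterate_seed, supportCard_eq_add_parity (finite_support_iterate_seed _),
    iterate_two_mul_add_one_seed]
  simp only [T528_dilate_even_even, T528_dilate_even_odd, T528_dilate_odd_even,
    T528_dilate_odd_odd, supportCard_zero, add_zero]
  have h1 := edgeNum_eq_vertical n
  have h2 : edgeNum n = supportCard fun p => (T528^[n] singleSiteSeed) (p.1, p.2) +
    (T528^[n] singleSiteSeed) (p.1 + 1, p.2) := rfl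
  have h3 : num T528 n = supportCard fun p => (T528^[n] singleSiteSeed) (p.1, p.2) := rfl
  simp only [Prod.mk.eta] at h1 h2 h3 ⊢
  omega

theorem edgeNum_two_mul (n : ℕ) : edgeNum (2 * n) = 2 * num T528 n := by
  rw [edgeNum, supportCard_eq_add_parity (finite_support_edge _), iterate_two_mul_seed]
  have e : ∀ a : ℤ, 2 * a + 1 + 1 = 2 * (a + 1) := fun a => by ring
  simp only [e, dilate_apply _ _ rfl rfl, dilate_apply_odd_fst _ rfl, dilate_apply_odd_snd _ rfl,
    supportCard_zero, add_zero, zero_add]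
  have h := supportCard_comp_add (T528^[n] singleSiteSeed) 1 0
  simp only [add_zero] at h
  rw [h, two_mul]
  rfl

theorem edgeNum_two_mul_add_one (n : ℕ) :
    edgeNum (2 * n + 1) = 2 * num T528 n + 2 * edgeNum n := by
  rw [edgeNum, supportCard_eq_add_parity (finite_support_edge _), iterate_two_mul_add_one_seed]
  have e : ∀ a : ℤ, 2 * a + 1 + 1 = 2 * (a + 1) := fun a => by ring
  -- Terms occurring twice cancel modulo `2`.
  have c1 : ∀ s t : ZMod 2, s + (s + t) = t := fun s t => by
    rw [← add_assoc, CharTwo.add_self_eq_zero, zero_add]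
  have c2 : ∀ s t : ZMod 2, s + t + t = s := fun s t => by
    rw [add_assoc, CharTwo.add_self_eq_zero, add_zero]
  simp only [e, T528_dilate_even_even, T528_dilate_even_odd, T528_dilate_odd_even,
    T528_dilate_odd_odd, c1, c2, add_zero, zero_add]
  have h1 := supportCard_comp_add (T528^[n] singleSiteSeed) 1 0
  have h2 := supportCard_comp_add (fun p => (T528^[n] singleSiteSeed) p +
    (T528^[n] singleSiteSeed) (p.1, p.2 + 1)) 1 0
  have h3 := edgeNum_eq_vertical n
  have h4 : num T528 n = supportCard fun p => (T528^[n] singleSiteSeed) p := rfl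
  simp only [add_zero, Prod.mk.eta] at h1 h2 h3 ⊢
  change _ = supportCard fun p => (T528^[n] singleSiteSeed) p at h1
  omega

theorem edgeNum_zero : edgeNum 0 = 2 := by
  have h := edgeNum_two_mul 0
  rwa [mul_zero, num_zero] at h

/-! ### The binary digits of the time step -/

/-- A digit `0` separates the digits above it from those below: on even numbers the pair
`(num, edgeNum)` is a multiple of its value `(1, 2)` at `0`, and both recursions are linear. -/
theorem num_edgeNum_concat (M j : ℕ) : ∀ m < 2 ^ j,
    num T528 (2 ^ (j + 1) * M + m) = num T528 M * num T528 m ∧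
      edgeNum (2 ^ (j + 1) * M + m) = num T528 M * edgeNum m := by
  induction j with
  | zero =>
    intro m hm
    obtain rfl : m = 0 := by simpa using hm
    simp only [zero_add, pow_one, add_zero, num_two_mul, edgeNum_two_mul, num_zero, edgeNum_zero]
    exact ⟨(mul_one _).symm, mul_comm _ _⟩
  | succ j ih =>
    intro m hm
    rw [pow_succ] at hm
    rcases Nat.even_or_odd' m with ⟨q, rfl | rfl⟩
    · obtain ⟨h1, -⟩ := ih q (by omega)
      rw [show 2 ^ (j + 1 + 1) * M + 2 * q = 2 * (2 ^ (j + 1) * M + q) by ring]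
      rw [num_two_mul, num_two_mul, edgeNum_two_mul, edgeNum_two_mul, h1]
      exact ⟨rfl, by ring⟩
    · obtain ⟨h1, h2⟩ := ih q (by omega)
      rw [show 2 ^ (j + 1 + 1) * M + (2 * q + 1) = 2 * (2 ^ (j + 1) * M + q) + 1 by ring]
      simp only [num_two_mul_add_one, edgeNum_two_mul_add_one, h1, h2]
      constructor <;> ring

theorem num_concat (M : ℕ) {j m : ℕ} (hm : m < 2 ^ j) :
    num T528 (2 ^ (j + 1) * M + m) = num T528 M * num T528 m :=
  (num_edgeNum_concat M j m hm).1

theorem num_edgeNum_le (j : ℕ) : ∀ m < 2 ^ j,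
    num T528 m ≤ 2 * 4 ^ j ∧ edgeNum m ≤ 3 * 4 ^ j := by
  induction j with
  | zero =>
    intro m hm
    obtain rfl : m = 0 := by simpa using hm
    simp [num_zero, edgeNum_zero]
  | succ j ih =>
    intro m hm
    rw [pow_succ] at hm
    rw [pow_succ]
    rcases Nat.even_or_odd' m with ⟨q, rfl | rfl⟩
    · obtain ⟨h1, h2⟩ := ih q (by omega)
      rw [num_two_mul, edgeNum_two_mul]
      omega
    · obtain ⟨h1, h2⟩ := ih q (by omega)
      rw [num_two_mul_add_one, edgeNum_two_mul_add_one]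
      omega

theorem num_le {j m : ℕ} (hm : m < 2 ^ j) : num T528 m ≤ 2 * 4 ^ j :=
  (num_edgeNum_le j m hm).1

/-- The numbers `λ_± = (3 ± √17) / 2` are the eigenvalues of the recursion for a digit `1`. -/
theorem num_edgeNum_two_pow_sub_one (s : ℕ) :
    (num T528 (2 ^ s - 1) : ℝ) = clusterFactor s ∧
      (num T528 (2 ^ s - 1) : ℝ) + 2 * edgeNum (2 ^ s - 1) = clusterFactor (s + 1) := by
  have hsq : √17 ^ 2 = (17 : ℝ) := Real.sq_sqrt (by norm_num)
  induction s with
  | zero =>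
    simp only [pow_zero, tsub_self, num_zero, edgeNum_zero, clusterFactor, zero_add, pow_one]
    constructor
    · push_cast
      ring
    · push_cast
      linear_combination (-7 / 34) * hsq
  | succ s ih =>
    obtain ⟨h1, h2⟩ := ih
    have hs : 2 ^ (s + 1) - 1 = 2 * (2 ^ s - 1) + 1 := by
      have := Nat.one_le_two_pow (n := s)
      rw [pow_succ]
      omega
    rw [hs, num_two_mul_add_one, edgeNum_two_mul_add_one]
    push_cast
    refine ⟨h2, ?_⟩
    -- Cayley-Hamilton: the sequence satisfies `c (s + 2) = 3 * c (s + 1) + 2 * c s`.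
    have hrec : clusterFactor (s + 1 + 1) = 3 * clusterFactor (s + 1) + 2 * clusterFactor s := by
      simp only [clusterFactor, pow_succ]
      linear_combination ((17 + 7 * √17) / 34 * ((3 + √17) / 2) ^ s / 4 +
        (17 - 7 * √17) / 34 * ((3 - √17) / 2) ^ s / 4) * hsq
    rw [hrec]
    linear_combination 3 * h2 + 2 * h1

theorem num_two_pow_sub_one (s : ℕ) : (num T528 (2 ^ s - 1) : ℝ) = clusterFactor s :=
  (num_edgeNum_two_pow_sub_one s).1

/-! ### Cumulative numbers -/

theorem sum_range_two_mul (f : ℕ → ℕ) (n : ℕ) :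
    ∑ m ∈ Finset.range (2 * n), f m = ∑ m ∈ Finset.range n, (f (2 * m) + f (2 * m + 1)) := by
  induction n with
  | zero => rfl
  | succ n ih =>
    rw [show 2 * (n + 1) = 2 * n + 1 + 1 by ring, Finset.sum_range_succ, Finset.sum_range_succ, ih,
      Finset.sum_range_succ, add_assoc]

/-- The number of nonzero cells in the first `2 ^ k` time steps. -/
noncomputable def blockSum (k : ℕ) : ℕ := ∑ m ∈ Finset.range (2 ^ k), num T528 m

theorem blockSum_zero : blockSum 0 = 1 := by simp [blockSum, num_zero]

theorem blockSum_succ (k : ℕ) :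
    blockSum (k + 1) = 2 * blockSum k + 2 * ∑ m ∈ Finset.range (2 ^ k), edgeNum m := by
  rw [blockSum, pow_succ', sum_range_two_mul, blockSum, Finset.mul_sum, Finset.mul_sum,
    ← Finset.sum_add_distrib]
  refine Finset.sum_congr rfl fun m _ => ?_
  rw [num_two_mul, num_two_mul_add_one]
  ring

theorem sum_edgeNum_succ (k : ℕ) : ∑ m ∈ Finset.range (2 ^ (k + 1)), edgeNum m =
    4 * blockSum k + 2 * ∑ m ∈ Finset.range (2 ^ k), edgeNum m := by
  rw [pow_succ', sum_range_two_mul, blockSum, Finset.mul_sum, Finset.mul_sum,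
    ← Finset.sum_add_distrib]
  refine Finset.sum_congr rfl fun m _ => ?_
  rw [edgeNum_two_mul, edgeNum_two_mul_add_one]
  ring

theorem blockSum_one : blockSum 1 = 6 := by
  rw [blockSum_succ, blockSum_zero]
  simp [edgeNum_zero]

theorem blockSum_add_two (k : ℕ) :
    blockSum (k + 2) = 4 * blockSum (k + 1) + 4 * blockSum k := by
  have h1 := blockSum_succ (k + 1)
  have h2 := blockSum_succ k
  rw [sum_edgeNum_succ] at h1
  simp only [add_assoc, Nat.reduceAdd] at h1
  omega

theorem blockSum_succ_bounds (k : ℕ) :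
    9 * blockSum k ≤ 2 * blockSum (k + 1) ∧ blockSum (k + 1) ≤ 6 * blockSum k := by
  induction k with
  | zero => rw [zero_add, blockSum_one, blockSum_zero]; omega
  | succ k ih =>
    have := blockSum_add_two k
    simp only [add_assoc, Nat.reduceAdd]
    omega

theorem blockSum_pos (k : ℕ) : 0 < blockSum k := by
  induction k with
  | zero => rw [blockSum_zero]; omega
  | succ k ih =>
    have := (blockSum_succ_bounds k).1
    omega

theorem blockSum_le_of_add (k i : ℕ) : (blockSum k : ℝ) ≤ (2 / 9) ^ i * blockSum (k + i) := by
  induction i with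
  | zero => simp
  | succ i ih =>
    have h : (9 * blockSum (k + i) : ℝ) ≤ 2 * blockSum (k + i + 1) := by
      exact_mod_cast (blockSum_succ_bounds (k + i)).1
    calc (blockSum k : ℝ) ≤ (2 / 9) ^ i * blockSum (k + i) := ih
      _ ≤ (2 / 9) ^ i * (2 / 9 * blockSum (k + i + 1)) := by gcongr; linarith
      _ = (2 / 9) ^ (i + 1) * blockSum (k + (i + 1)) := by rw [pow_succ]; ring_nf

theorem blockSum_eq (k : ℕ) : (blockSum k : ℝ) =
    (1 + √2) / 2 * (2 + 2 * √2) ^ k + (1 - √2) / 2 * (2 - 2 * √2) ^ k := by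
  have hsq : √2 ^ 2 = (2 : ℝ) := Real.sq_sqrt (by norm_num)
  induction k using Nat.twoStepInduction with
  | zero => rw [blockSum_zero]; push_cast; ring
  | one => rw [blockSum_one]; push_cast; linear_combination (-2) * hsq
  | more k h1 h2 =>
    rw [blockSum_add_two]
    push_cast
    rw [h1, h2]
    simp only [pow_succ]
    linear_combination (-4 * ((1 + √2) / 2 * (2 + 2 * √2) ^ k + (1 - √2) / 2 * (2 - 2 * √2) ^ k)) *
      hsq

/-- The constant `α = (√2 - 1) / 2` is the reciprocal of the dominant eigenvalue `2 + 2 √2`. -/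
theorem tendsto_blockSum_mul_pow :
    Tendsto (fun k => (blockSum k : ℝ) * ((√2 - 1) / 2) ^ k) atTop (𝓝 ((1 + √2) / 2)) := by
  have hsq : √2 ^ 2 = (2 : ℝ) := Real.sq_sqrt (by norm_num)
  have h1 : (1 : ℝ) < √2 := by rw [Real.lt_sqrt] <;> norm_num
  have h2 : √2 < 3 / 2 := by rw [Real.sqrt_lt'] <;> norm_num
  have hlim : Tendsto (fun k : ℕ => (1 + √2) / 2 + (1 - √2) / 2 * (-(√2 - 1) ^ 2) ^ k) atTop
      (𝓝 ((1 + √2) / 2 + (1 - √2) / 2 * 0)) := by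
    refine tendsto_const_nhds.add (tendsto_const_nhds.mul
      (tendsto_pow_atTop_nhds_zero_of_abs_lt_one ?_))
    rw [abs_lt]
    constructor <;> nlinarith
  rw [mul_zero, add_zero] at hlim
  refine hlim.congr fun k => ?_
  rw [blockSum_eq, add_mul, mul_assoc, mul_assoc, ← mul_pow, ← mul_pow]
  have e1 : (2 + 2 * √2) * ((√2 - 1) / 2) = 1 := by linear_combination hsq
  have e2 : (2 - 2 * √2) * ((√2 - 1) / 2) = -(√2 - 1) ^ 2 := by ring
  rw [e1, e2, one_pow, mul_one]

theorem tendsto_blockSum_sub_div (i : ℕ) :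
    Tendsto (fun k => (blockSum (k - i) : ℝ) / blockSum k) atTop (𝓝 (((√2 - 1) / 2) ^ i)) := by
  have h1 : (1 : ℝ) < √2 := by rw [Real.lt_sqrt] <;> norm_num
  have hα : 0 < (√2 - 1) / 2 := by linarith
  have hc : (1 + √2) / 2 ≠ 0 := by positivity
  have h := (((tendsto_blockSum_mul_pow.comp (tendsto_sub_atTop_nat i)).div
    tendsto_blockSum_mul_pow hc).mul_const (((√2 - 1) / 2) ^ i))
  rw [div_self hc, one_mul] at h
  refine h.congr' ?_
  filter_upwards [eventually_ge_atTop i] with k hk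
  have hA : (blockSum k : ℝ) ≠ 0 := by exact_mod_cast (blockSum_pos k).ne'
  obtain ⟨j, rfl⟩ := Nat.exists_eq_add_of_le hk
  simp only [Function.comp_apply, Nat.add_sub_cancel_left, Pi.div_apply]
  rw [pow_add]
  field_simp

/-! ### Binary words -/

/-- The number with binary digits `x_1 x_2 ⋯ x_m`. -/
def prefixValue (x : ℕ → Fin 2) : ℕ → ℕ
  | 0 => 0
  | m + 1 => 2 * prefixValue x m + (x (m + 1) : ℕ)

theorem prefixValue_lt (x : ℕ → Fin 2) (m : ℕ) : prefixValue x m < 2 ^ m := by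
  induction m with
  | zero => simp [prefixValue]
  | succ m ih =>
    have := (x (m + 1)).isLt
    rw [prefixValue, pow_succ]
    omega

theorem sum_digits_eq_prefixValue (x : ℕ → Fin 2) (k : ℕ) :
    ∑ i ∈ Finset.Icc 1 k, ((x i : ℕ) : ℤ) * 2 ^ (k - i) = prefixValue x k := by
  induction k with
  | zero => rfl
  | succ k ih =>
    rw [Finset.sum_Icc_succ_top (by omega), prefixValue]
    push_cast
    rw [← ih, Finset.mul_sum, Nat.sub_self, pow_zero, mul_one]
    congr 1
    refine Finset.sum_congr rfl fun i hi => ?_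
    rw [Nat.sub_add_comm (Finset.mem_Icc.mp hi).2, pow_succ]
    ring

theorem normalizedCum_eq (x : ℕ → Fin 2) (k : ℕ) : normalizedCum T528 x k =
    ((∑ m ∈ Finset.range (prefixValue x k), num T528 m : ℕ) : ℝ) / blockSum k := by
  rw [normalizedCum, sum_digits_eq_prefixValue, cum, cum, blockSum, sub_add_cancel, sub_add_cancel,
    Int.toNat_natCast]
  norm_cast

/-- The times before `prefixValue x k * 2 ^ j` are grouped by the first digit in which they are
smaller; each group is a block of times that share the digits above a `0`. -/
theorem sum_num_prefixValue (x : ℕ → Fin 2) (k j : ℕ) :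
    ∑ m ∈ Finset.range (prefixValue x k * 2 ^ j), num T528 m =
      ∑ i ∈ Finset.range k,
        (x (i + 1) : ℕ) * num T528 (prefixValue x i) * blockSum (k + j - (i + 1)) := by
  induction k generalizing j with
  | zero => simp [prefixValue]
  | succ k ih =>
    rw [Finset.sum_range_succ, show k + 1 + j - (k + 1) = j by omega]
    have hk := ih (j + 1)
    rw [show k + (j + 1) = k + 1 + j by ring] at hk
    rw [← hk, prefixValue]
    rcases Fin.exists_fin_two.mp ⟨x (k + 1), rfl⟩ with h | h
    · rw [h, Fin.val_zero, zero_mul, zero_mul, add_zero, add_zero, pow_succ', ← mul_assoc,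
        mul_comm 2 (prefixValue x k)]
    · simp only [h, Fin.val_one, one_mul]
      rw [show (2 * prefixValue x k + 1) * 2 ^ j = prefixValue x k * 2 ^ (j + 1) + 2 ^ j by ring,
        Finset.sum_range_add, blockSum, Finset.mul_sum]
      congr 1
      refine Finset.sum_congr rfl fun m hm => ?_
      rw [mul_comm (prefixValue x k), num_concat _ (Finset.mem_range.mp hm)]

/-! ### Clusters of ones -/

/-- A word that ends in `0` has the same clusters as the word without that digit. -/
theorem clusterCount_succ_of_eq_zero {x : ℕ → Fin 2} {m : ℕ} (hm : 1 ≤ m) (h : x m = 0) (s : ℕ) :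
    clusterCount x (m + 1) s = clusterCount x m s := by
  unfold clusterCount
  congr 1
  ext a
  simp only [Finset.mem_filter, Finset.mem_Icc, Finset.mem_Ico]
  constructor
  · rintro ⟨⟨h1, h2⟩, h3, h4, h5, h6, h7⟩
    have hne : a + s ≠ m + 1 := by
      intro e
      have := h5 m ⟨by omega, by omega⟩
      simp [h] at this
    refine ⟨⟨h1, by omega⟩, h3, by omega, h5, h6, ?_⟩
    exact Or.inr (h7.resolve_left hne)
  · rintro ⟨⟨h1, h2⟩, h3, h4, h5, h6, h7⟩
    refine ⟨⟨h1, by omega⟩, h3, by omega, h5, h6, Or.inr ?_⟩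
    rcases h7 with e | e
    · rw [e, h]
    · exact e

/-- A word that ends in a cluster of ones, at the positions `t, …, m`, has that cluster in addition
to those of the word `x_1 ⋯ x_{t-1}`. -/
theorem clusterCount_succ_of_ones {x : ℕ → Fin 2} {t m : ℕ} (ht : 1 ≤ t) (htm : t ≤ m)
    (hones : ∀ j, t ≤ j → j ≤ m → x j = 1) (hstart : t = 1 ∨ x (t - 1) = 0) (s : ℕ) :
    clusterCount x (m + 1) s = clusterCount x t s + if s = m + 1 - t then 1 else 0 := by
  have key : ((Finset.Icc 1 (m + 1 - 1)).filter fun a =>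
      1 ≤ s ∧ a + s ≤ m + 1 ∧ (∀ j ∈ Finset.Ico a (a + s), x j = 1) ∧
      (a = 1 ∨ x (a - 1) = 0) ∧ (a + s = m + 1 ∨ x (a + s) = 0)) =
      ((Finset.Icc 1 (t - 1)).filter fun a =>
      1 ≤ s ∧ a + s ≤ t ∧ (∀ j ∈ Finset.Ico a (a + s), x j = 1) ∧
      (a = 1 ∨ x (a - 1) = 0) ∧ (a + s = t ∨ x (a + s) = 0)) ∪
      if s = m + 1 - t then {t} else ∅ := by
    ext a
    simp only [Finset.mem_union, Finset.mem_filter, Finset.mem_Icc, Finset.mem_Ico]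
    constructor
    · rintro ⟨⟨h1, h2⟩, h3, h4, h5, h6, h7⟩
      rcases lt_trichotomy a t with hat | rfl | hat
      · left
        have h0 : x (t - 1) = 0 := hstart.resolve_left (by omega)
        have hle : a + s ≤ t - 1 := by
          by_contra hcon
          have := h5 (t - 1) ⟨by omega, by omega⟩
          simp [h0] at this
        exact ⟨⟨h1, by omega⟩, h3, by omega, h5, h6, Or.inr (h7.resolve_left (by omega))⟩
      · right
        have hs : s = m + 1 - a := by
          rcases h7 with e | e
          · omega
          · by_contra hcon
            have := hones (a + s) (by omega) (by omega)
            simp [e] at this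
        simp [hs]
      · exfalso
        have h0 : x (a - 1) = 0 := h6.resolve_left (by omega)
        have := hones (a - 1) (by omega) (by omega)
        simp [h0] at this
    · rintro (⟨⟨h1, h2⟩, h3, h4, h5, h6, h7⟩ | h)
      · have h0 : x (t - 1) = 0 := hstart.resolve_left (by omega)
        have hne : a + s ≠ t := by
          intro e
          have := h5 (t - 1) ⟨by omega, by omega⟩
          simp [h0] at this
        exact ⟨⟨h1, by omega⟩, h3, by omega, h5, h6, Or.inr (h7.resolve_left hne)⟩
      · split_ifs at h with hs
        · obtain rfl := Finset.mem_singleton.mp h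
          refine ⟨⟨ht, by omega⟩, by omega, by omega, fun j hj => ?_, hstart, Or.inl (by omega)⟩
          exact hones j hj.1 (by omega)
        · simp at h
  unfold clusterCount
  rw [key, Finset.card_union_of_disjoint]
  · congr 1
    split_ifs <;> simp
  · rw [Finset.disjoint_left]
    intro a ha hb
    split_ifs at hb with hs
    · obtain rfl := Finset.mem_singleton.mp hb
      have := (Finset.mem_Icc.mp (Finset.mem_filter.mp ha).1).2
      omega
    · simp at hb

theorem prefixValue_of_ones {x : ℕ → Fin 2} {t r : ℕ}
    (hones : ∀ j, t < j → j ≤ t + r → x j = 1) :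
    prefixValue x (t + r) = 2 ^ r * prefixValue x t + (2 ^ r - 1) := by
  induction r with
  | zero => simp
  | succ r ih =>
    rw [← add_assoc, prefixValue, ih fun j h1 h2 => hones j h1 (by omega),
      hones (t + r + 1) (by omega) (by omega), pow_succ, Fin.val_one]
    have := Nat.one_le_two_pow (n := r)
    rw [show 2 ^ r * 2 * prefixValue x t = 2 * (2 ^ r * prefixValue x t) by ring]
    omega

/-- A word that ends in `1` has a last cluster, from position `t + 1` to its end. -/
theorem exists_last_cluster (x : ℕ → Fin 2) {m : ℕ} (hm : x m = 1) (hm1 : 1 ≤ m) :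
    ∃ t < m, (∀ j, t < j → j ≤ m → x j = 1) ∧ (t = 0 ∨ x t = 0) := by
  induction m with
  | zero => omega
  | succ m ih =>
    by_cases h0 : m = 0 ∨ x m = 0
    · refine ⟨m, by omega, fun j h1 h2 => ?_, h0⟩
      rwa [show j = m + 1 by omega]
    · push Not at h0
      obtain ⟨t, ht, h1, h2⟩ := ih (Fin.eq_one_of_ne_zero _ h0.2) (by omega)
      refine ⟨t, by omega, fun j h3 h4 => ?_, h2⟩
      rcases Nat.le_or_eq_of_le_succ h4 with h | h
      · exact h1 j h3 h
      · rwa [h]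

/-- The clusters of a word contribute independent factors to the number of nonzero cells. The
bound `K` on their lengths is arbitrary, as longer clusters do not occur. -/
theorem num_prefixValue (x : ℕ → Fin 2) (m : ℕ) : ∀ K ≥ m + 1,
    (num T528 (prefixValue x m) : ℝ) =
      ∏ s ∈ Finset.range K, clusterFactor s ^ clusterCount x (m + 1) s := by
  induction m using Nat.strong_induction_on with
  | _ m ih =>
    intro K hK
    rcases Nat.eq_zero_or_pos m with rfl | hm
    · simp [prefixValue, num_zero, clusterCount]
    by_cases h : x m = 0
    · obtain ⟨n, rfl⟩ := Nat.exists_eq_add_of_lt hm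
      rw [zero_add] at *
      simp only [clusterCount_succ_of_eq_zero hm h]
      rw [← ih n (by omega) K (by omega), prefixValue, h, Fin.val_zero, add_zero, num_two_mul]
    · obtain ⟨t, htm, hones, hstart⟩ := exists_last_cluster x (Fin.eq_one_of_ne_zero _ h) hm
      obtain ⟨r, rfl⟩ := Nat.exists_eq_add_of_le htm.le
      have hc := clusterCount_succ_of_ones (x := x) (t := t + 1) (m := t + r) (by omega) (by omega)
        (fun j h1 h2 => hones j (by omega) h2) (by simpa using hstart)
      have hr : t + r + 1 - (t + 1) = r := by omega
      simp only [hc, hr, pow_add, Finset.prod_mul_distrib, pow_ite, pow_one, pow_zero]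
      rw [← ih t htm K (by omega), Finset.prod_ite_eq' , if_pos (Finset.mem_range.mpr (by omega)),
        prefixValue_of_ones hones, ← num_two_pow_sub_one, ← Nat.cast_mul]
      congr 1
      -- The word before the last cluster is empty or ends in `0`, so its value is even.
      obtain ⟨M, hM⟩ : ∃ M, prefixValue x t = 2 * M := by
        rcases hstart with rfl | h0
        · exact ⟨0, rfl⟩
        · rcases t with _ | t
          · exact ⟨0, rfl⟩
          · exact ⟨prefixValue x t, by rw [prefixValue, h0, Fin.val_zero, add_zero]⟩
      rw [hM, ← mul_assoc, ← pow_succ, num_concat _ (by have := Nat.one_le_two_pow (n := r); omega),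
        num_two_mul]

/-! ### The limit -/

theorem num_prefixValue_le (x : ℕ → Fin 2) (i : ℕ) :
    (num T528 (prefixValue x i) : ℝ) ≤ 2 * 4 ^ i := by
  exact_mod_cast num_le (prefixValue_lt x i)

theorem digit_le_one (x : ℕ → Fin 2) (i : ℕ) : ((x i : ℕ) : ℝ) ≤ 1 := by
  exact_mod_cast Nat.lt_succ_iff.mp (x i).isLt

/-- The bound that makes the series converge and dominates the terms of the normalized numbers:
`num n ≤ 2 * 4 ^ i` for `n < 2 ^ i` grows more slowly than `(9 / 2) ^ i`, a lower bound for the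
growth of `blockSum`. -/
theorem limit_term_bound (x : ℕ → Fin 2) (i : ℕ) {c : ℝ} (hc0 : 0 ≤ c)
    (hc : c ≤ (2 / 9) ^ (i + 1)) :
    ‖((x (i + 1) : ℕ) : ℝ) * num T528 (prefixValue x i) * c‖ ≤ 4 / 9 * (8 / 9) ^ i := by
  rw [Real.norm_of_nonneg (by positivity)]
  calc ((x (i + 1) : ℕ) : ℝ) * num T528 (prefixValue x i) * c
      ≤ 1 * (2 * 4 ^ i) * (2 / 9) ^ (i + 1) := by
        gcongr
        · exact digit_le_one x _
        · exact num_prefixValue_le x i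
    _ = 4 / 9 * (8 / 9) ^ i := by
        rw [show (8 / 9 : ℝ) = 4 * (2 / 9) by norm_num, mul_pow, pow_succ]
        ring

theorem summable_limit_bound : Summable fun i : ℕ => (4 / 9 : ℝ) * (8 / 9) ^ i :=
  (summable_geometric_of_lt_one (by norm_num) (by norm_num)).mul_left _

theorem summable_limit_term (x : ℕ → Fin 2) : Summable fun i : ℕ =>
    ((x (i + 1) : ℕ) : ℝ) * num T528 (prefixValue x i) * ((√2 - 1) / 2) ^ (i + 1) := by
  have h1 : (1 : ℝ) < √2 := by rw [Real.lt_sqrt] <;> norm_num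
  have h2 : √2 < 13 / 9 := by rw [Real.sqrt_lt'] <;> norm_num
  have hα : 0 ≤ (√2 - 1) / 2 := by linarith
  refine Summable.of_norm_bounded summable_limit_bound fun i =>
    limit_term_bound x i (by positivity) (pow_le_pow_left₀ hα (by linarith) _)

theorem tendsto_normalizedCum (x : ℕ → Fin 2) : Tendsto (normalizedCum T528 x) atTop
    (𝓝 (∑' i : ℕ,
      ((x (i + 1) : ℕ) : ℝ) * num T528 (prefixValue x i) * ((√2 - 1) / 2) ^ (i + 1))) := by
  have hsum : ∀ k, normalizedCum T528 x k = ∑' i : ℕ, ((x (i + 1) : ℕ) : ℝ) *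
      num T528 (prefixValue x i) *
        (if i < k then (blockSum (k - (i + 1)) : ℝ) / blockSum k else 0) := by
    intro k
    rw [tsum_eq_sum (s := Finset.range k) fun i hi => by
      rw [if_neg (by simpa using hi), mul_zero], normalizedCum_eq]
    have h := sum_num_prefixValue x k 0
    rw [pow_zero, mul_one, add_zero] at h
    rw [h]
    push_cast
    rw [Finset.sum_div]
    refine Finset.sum_congr rfl fun i hi => ?_
    rw [if_pos (Finset.mem_range.mp hi), mul_div_assoc]
  rw [funext hsum]
  refine tendsto_tsum_of_dominated_convergence summable_limit_bound (fun i => ?_)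
    (Eventually.of_forall fun k i => limit_term_bound x i ?_ ?_)
  · refine tendsto_const_nhds.mul ((tendsto_blockSum_sub_div (i + 1)).congr' ?_)
    filter_upwards [eventually_gt_atTop i] with k hk
    rw [if_pos hk]
  · split_ifs <;> positivity
  · split_ifs with hik
    · have hA : (0 : ℝ) < blockSum k := by exact_mod_cast blockSum_pos k
      rw [div_le_iff₀ hA]
      have h := blockSum_le_of_add (k - (i + 1)) (i + 1)
      rwa [Nat.sub_add_cancel hik] at h
    · positivity

theorem normalizedCum_mem_Icc (x : ℕ → Fin 2) (k : ℕ) :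
    normalizedCum T528 x k ∈ Set.Icc (0 : ℝ) 1 := by
  rw [normalizedCum_eq]
  refine ⟨by positivity, div_le_one_of_le₀ ?_ (by positivity)⟩
  rw [blockSum]
  exact_mod_cast Finset.sum_le_sum_of_subset
    (Finset.range_subset_range.mpr (prefixValue_lt x k).le)

theorem binaryValue_mul_two_pow (x : ℕ → Fin 2) (k : ℕ) :
    (binaryValue x : ℝ) * 2 ^ k =
      prefixValue x k + Real.ofDigits (fun i => x (i + 1 + k)) := by
  induction k with
  | zero => simp [prefixValue, binaryValue]
  | succ k ih =>
    have h := Real.ofDigits_eq_sum_add_ofDigits (fun i => x (i + 1 + k)) 1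
    simp only [Finset.sum_range_one, Real.ofDigitsTerm, zero_add, pow_one] at h
    have e : (fun i => x (i + 1 + 1 + k)) = fun i => x (i + 1 + (k + 1)) := by
      funext i
      congr 1
      ring
    rw [e, add_comm 1 k] at h
    rw [pow_succ, ← mul_assoc, ih, h, prefixValue]
    push_cast
    ring

theorem prefixValue_le_of_binaryValue_eq {x y : ℕ → Fin 2} (h : binaryValue x = binaryValue y)
    (k : ℕ) : prefixValue x k ≤ prefixValue y k + 1 := by
  have hx := binaryValue_mul_two_pow x k
  have hy := binaryValue_mul_two_pow y k
  have h0 := Real.ofDigits_nonneg fun i => x (i + 1 + k)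
  have h1 := Real.ofDigits_le_one fun i => y (i + 1 + k)
  rw [h] at hx
  have : (prefixValue x k : ℝ) ≤ prefixValue y k + 1 := by linarith
  exact_mod_cast this

/-- The prefixes of two expansions of the same number differ by at most one, so the cumulative
numbers differ by at most one term `num n` with `n < 2 ^ k`, which is negligible. -/
theorem normalizedCum_le_of_binaryValue_eq {x y : ℕ → Fin 2} (h : binaryValue x = binaryValue y)
    (k : ℕ) : normalizedCum T528 x k ≤ normalizedCum T528 y k + 2 * (8 / 9) ^ k := by
  have hA : (0 : ℝ) < blockSum k := by exact_mod_cast blockSum_pos k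
  have hle : ∑ m ∈ Finset.range (prefixValue x k), num T528 m ≤
      ∑ m ∈ Finset.range (prefixValue y k), num T528 m + 2 * 4 ^ k := by
    calc ∑ m ∈ Finset.range (prefixValue x k), num T528 m
        ≤ ∑ m ∈ Finset.range (prefixValue y k + 1), num T528 m :=
          Finset.sum_le_sum_of_subset
            (Finset.range_subset_range.mpr (prefixValue_le_of_binaryValue_eq h k))
      _ ≤ _ := by
          rw [Finset.sum_range_succ]
          exact Nat.add_le_add_left (num_le (prefixValue_lt y k)) _
  have hpow : (4 : ℝ) ^ k ≤ (8 / 9) ^ k * blockSum k := by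
    have h0 := blockSum_le_of_add 0 k
    rw [blockSum_zero, zero_add, Nat.cast_one] at h0
    calc (4 : ℝ) ^ k = 4 ^ k * 1 := (mul_one _).symm
      _ ≤ 4 ^ k * ((2 / 9) ^ k * blockSum k) := by gcongr
      _ = (8 / 9) ^ k * blockSum k := by rw [← mul_assoc, ← mul_pow]; norm_num
  rw [normalizedCum_eq, normalizedCum_eq, div_le_iff₀ hA, add_mul, div_mul_cancel₀ _ hA.ne']
  have hle' : ((∑ m ∈ Finset.range (prefixValue x k), num T528 m : ℕ) : ℝ) ≤
      ((∑ m ∈ Finset.range (prefixValue y k), num T528 m : ℕ) : ℝ) + 2 * 4 ^ k := by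
    exact_mod_cast hle
  linarith

theorem limit_le_of_binaryValue_eq {x y : ℕ → Fin 2} (h : binaryValue x = binaryValue y)
    {a b : ℝ} (hx : Tendsto (normalizedCum T528 x) atTop (𝓝 a))
    (hy : Tendsto (normalizedCum T528 y) atTop (𝓝 b)) : a ≤ b := by
  have hpow : Tendsto (fun k : ℕ => (2 : ℝ) * (8 / 9) ^ k) atTop (𝓝 (2 * 0)) :=
    tendsto_const_nhds.mul (tendsto_pow_atTop_nhds_zero_of_lt_one (by norm_num) (by norm_num))
  have hy' := hy.add hpow
  rw [mul_zero, add_zero] at hy'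
  exact le_of_tendsto_of_tendsto' hx hy' (normalizedCum_le_of_binaryValue_eq h)

theorem binaryValue_surjective : Function.Surjective binaryValue := by
  rintro ⟨v, hv⟩
  obtain ⟨d, -, hd⟩ := Real.ofDigits_SurjOn (b := 2) (by norm_num) hv
  exact ⟨fun i => d (i - 1), Subtype.ext hd⟩

theorem mainTheorem4 :
    (∃! f : Set.Icc (0 : ℝ) 1 → Set.Icc (0 : ℝ) 1, IsLimitFunction T528 f) ∧
    ∀ f : Set.Icc (0 : ℝ) 1 → Set.Icc (0 : ℝ) 1, IsLimitFunction T528 f →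
      ∀ x : ℕ → Fin 2,
        HasSum
          (fun n : ℕ =>
            ((x (n + 1) : ℕ) : ℝ) * ((√2 - 1) / 2) ^ (n + 1) *
              ∏ s ∈ Finset.range (n + 1), clusterFactor s ^ clusterCount x (n + 1) s)
          (f (binaryValue x) : ℝ) := by
  refine ⟨?_, fun f hf x => ?_⟩
  · choose e he using binaryValue_surjective
    refine ⟨fun v => ⟨_, isClosed_Icc.mem_of_tendsto (tendsto_normalizedCum (e v))
      (Eventually.of_forall (normalizedCum_mem_Icc (e v)))⟩, fun x => ?_, fun g hg => ?_⟩
    · have hx := tendsto_normalizedCum x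
      have hy := tendsto_normalizedCum (e (binaryValue x))
      have heq := he (binaryValue x)
      rwa [le_antisymm (limit_le_of_binaryValue_eq heq.symm hx hy)
        (limit_le_of_binaryValue_eq heq hy hx)] at hx
    · funext v
      have h := hg (e v)
      rw [he v] at h
      exact Subtype.ext (tendsto_nhds_unique h (tendsto_normalizedCum (e v)))
  · rw [tendsto_nhds_unique (hf x) (tendsto_normalizedCum x)]
    convert (summable_limit_term x).hasSum using 2 with n
    rw [num_prefixValue x n (n + 1) le_rfl]
    ring
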